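/- Let $X\in\mathbb R^{n\times p}$ be a fixed design matrix, $B^*\in\mathbb R^{p\times m}$ a fixed matrix, $Y$ a random response matrix in $\mathbb R^{n\times m}$, and $l_0(\,\cdot\,;Y)$ a real-valued loss on $\mathbb R^{n\times m}$ that is differentiable in its first argument. For $B\in\mathbb R^{p\times m}$ let $\|B\|_{2,\mathcal C}$ denote the number of distinct rows of $B$, and put $r^*=\mathrm{rank}(B^*)$, $q^*=\|B^*\|_{2,\mathcal C}$. Write $\mathbf D_2(A_1,A_2)=\|A_1-A_2\|_F^2/2$ and $$\mathbf\Delta_{l_0}(A_1,A_2)=l_0(A_1;Y)-l_0(A_2;Y)-\langle\nabla l_0(A_2;Y),A_1-A_2\rangle .$$ Assume that the effective noise $E=-\nabla l_0(XB^*;Y)$ is sub-Gaussian with mean zero and scale bounded by $\sigma\ge 0$, i.e. $\mathbb E E=0$ and $\|\langle E,A\rangle\|_{\psi_2}\le\sigma\|A\|_F$ for all $A\in\mathbb R^{n\times m}$, where $\|Z\|_{\psi_2}=\inf\{t>0:\mathbb E\exp[(Z/t)^2]\le 2\}$. Let $r\ge r^*$ and $p\ge q\ge q^*$ be integers, and let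 $\hat B$ be an optimal solution of the clustered reduced-rank learning (CRL) problem, that is, a (measurable) global minimizer of $l_0(XB;Y)$ over all $B\in\mathbb R^{p\times m}$ with $\|B\|_{2,\mathcal C}\le q$ and $\mathrm{rank}(B)\le r$. Assume that there is a (nonrandom) $\delta>0$ such that, almost surely, $$\mathbf\Delta_{l_0}(XB_1,XB_2)\ge\delta\,\mathbf D_2(XB_1,XB_2)\qquad\text{for all } B_1,B_2 \text{ with } \|B_i\|_{2,\mathcal C}\le q,\ \mathrm{rank}(B_i)\le r .$$ Then $$\mathbb E\big[\|X\hat B-XB^*\|_F^2\big]\le \frac{C}{\delta^2}\big\{\sigma^2\,(q\wedge\mathrm{rank}(X)+m)\,r+\sigma^2(p-q)\log q+\sigma^2\big\},$$ where $C>0$ is a universal constant (and $0\cdot\log 0=0$ in the trivial case $p=q=0$). -/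

import Mathlib

open MeasureTheory

noncomputable section

namespace CRL

/-- The inner product `⟨A, B⟩` of two matrices, i.e. that of their vectorizations. -/
def frobInner {n m : ℕ} (A B : Matrix (Fin n) (Fin m) ℝ) : ℝ :=
  ∑ i, ∑ j, A i j * B i j

/-- The Frobenius norm. -/
def frobNorm {n m : ℕ} (A : Matrix (Fin n) (Fin m) ℝ) : ℝ :=
  √(∑ i, ∑ j, A i j ^ 2)

/-- `‖B‖_{2,𝒞}`: the number of distinct rows of `B`. -/
def numDistinctRows {p m : ℕ} (B : Matrix (Fin p) (Fin m) ℝ) : ℕ :=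
  (Set.range fun i => B.row i).ncard

/-- The constraint set `{B : ‖B‖_{2,𝒞} ≤ q, rank B ≤ r}`. -/
def constraintSet (p m q r : ℕ) : Set (Matrix (Fin p) (Fin m) ℝ) :=
  {B | numDistinctRows B ≤ q ∧ B.rank ≤ r}

/-- The gradient of a function of a matrix: the matrix of its partial derivatives, i.e. the matrix
which represents the Fréchet derivative with respect to `frobInner`. -/
def grad {n m : ℕ} (ψ : Matrix (Fin n) (Fin m) ℝ → ℝ) (Θ : Matrix (Fin n) (Fin m) ℝ) :
    Matrix (Fin n) (Fin m) ℝ :=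
  Matrix.of fun i j => fderiv ℝ ψ Θ (Matrix.single i j 1)

/-- The generalized Bregman function
`Δ_ψ(α, β) = ψ(α) - ψ(β) - ⟨∇ψ(β), α - β⟩`. -/
def bregman {n m : ℕ} (ψ : Matrix (Fin n) (Fin m) ℝ → ℝ) (α β : Matrix (Fin n) (Fin m) ℝ) : ℝ :=
  ψ α - ψ β - frobInner (grad ψ β) (α - β)

/-- `D₂(A, B) = ‖A - B‖_F² / 2`. -/
def D2 {n m : ℕ} (A B : Matrix (Fin n) (Fin m) ℝ) : ℝ :=
  frobNorm (A - B) ^ 2 / 2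

/-- The effective noise `E = -∇ l₀(X B*; Y)`; the loss `l₀` takes the systematic component first
and the response second. -/
def effectiveNoise {n p m : ℕ}
    (l₀ : Matrix (Fin n) (Fin m) ℝ → Matrix (Fin n) (Fin m) ℝ → ℝ)
    (X : Matrix (Fin n) (Fin p) ℝ) (Bstar : Matrix (Fin p) (Fin m) ℝ)
    (Y : Matrix (Fin n) (Fin m) ℝ) : Matrix (Fin n) (Fin m) ℝ :=
  -grad (fun Θ => l₀ Θ Y) (X * Bstar)

/-- `B` is a globally optimal solution of the CRL problem: it minimizes `l₀(X B; Y)` subject to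
`‖B‖_{2,𝒞} ≤ q` and `rank B ≤ r`. -/
def IsOptimalCRL {n p m : ℕ}
    (l₀ : Matrix (Fin n) (Fin m) ℝ → Matrix (Fin n) (Fin m) ℝ → ℝ)
    (X : Matrix (Fin n) (Fin p) ℝ) (Y : Matrix (Fin n) (Fin m) ℝ) (q r : ℕ)
    (B : Matrix (Fin p) (Fin m) ℝ) : Prop :=
  B ∈ constraintSet p m q r ∧ IsMinOn (fun B' => l₀ (X * B') Y) (constraintSet p m q r) B

/-- The norm `‖Z‖_{ψ₂} = inf {t > 0 : 𝔼 exp((Z / t)²) ≤ 2}`, with the value `∞` if there is no such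
`t`. -/
def psi2Norm {Ω : Type*} [MeasurableSpace Ω] (μ : Measure Ω) (Z : Ω → ℝ) : ENNReal :=
  ⨅ (t : ℝ) (_ : 0 < t) (_ : ∫⁻ ω, ENNReal.ofReal (Real.exp ((Z ω / t) ^ 2)) ∂μ ≤ 2),
    ENNReal.ofReal t

/-- `vec(E)` is a sub-Gaussian random vector with mean zero and scale bounded by `σ`. (The bound on
the marginals makes every entry integrable.) -/
structure IsSubGaussianNoise {Ω : Type*} [MeasurableSpace Ω] {n m : ℕ} (μ : Measure Ω)
    (E : Ω → Matrix (Fin n) (Fin m) ℝ) (σ : ℝ) : Prop where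
  aemeasurable : ∀ i j, AEMeasurable (fun ω => E ω i j) μ
  mean_zero : ∀ i j, ∫ ω, E ω i j ∂μ = 0
  psi2_le : ∀ A : Matrix (Fin n) (Fin m) ℝ,
    psi2Norm μ (fun ω => frobInner (E ω) A) ≤ ENNReal.ofReal (σ * frobNorm A)

end CRL

end

/-!
Optimality of `B̂` and restricted strong convexity give `δ ‖Δ‖² / 2 ≤ ⟨E, Δ⟩` for the error
`Δ = X B̂ - X B*`. This `Δ` has rank at most `2 r`, and once one of the `S(p, q) ≤ q ^ (2 (p - q))`
ways of grouping the rows of `B̂` is fixed, its columns lie in a space of dimension at most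
`2 (q ∧ rank X)`. Writing `Δ = L R` and covering the unit balls of the spaces of
left and of right factors by at most `5 ^ dim` balls of radius `1 / 2` yields a finite set `N` of
matrices of norm at most `1` such that `⟨E, Δ⟩ ≤ 4 |⟨E, D⟩| ‖Δ‖` for some `D ∈ N`. Hence
`‖Δ‖² ≤ 64 / δ² max_{D ∈ N} ⟨E, D⟩²`, and the maximum of `|N|` squares of variables with
`ψ₂`-norm at most `σ` has mean at most `σ² (log |N| + 1)`.
-/

namespace CRL

open Metric Module

section Coverings

variable {E F G : Type*} [NormedAddCommGroup E] [NormedSpace ℝ E]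
  [NormedAddCommGroup F] [NormedSpace ℝ F] [NormedAddCommGroup G] [NormedSpace ℝ G]

theorem card_le_of_isSeparated_closedBall [FiniteDimensional ℝ E] {s : Finset E}
    (hs : (s : Set E) ⊆ closedBall 0 1) (hsep : IsSeparated 2⁻¹ (s : Set E)) :
    s.card ≤ 5 ^ finrank ℝ E := by
  classical
  have hinj : Function.Injective fun x : E => (2 : ℝ) • x := smul_right_injective E two_ne_zero
  rw [← Finset.card_image_of_injective s hinj]
  refine Besicovitch.card_le_of_separated _ ?_ ?_
  · simp only [Finset.forall_mem_image, norm_smul, Real.norm_ofNat]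
    intro x hx
    linarith [mem_closedBall_zero_iff.1 (hs hx)]
  · simp only [Finset.forall_mem_image, ← smul_sub, norm_smul, Real.norm_ofNat]
    intro x hx y hy hxy
    have h : ENNReal.ofReal 2⁻¹ < ENNReal.ofReal (dist x y) := by
      rw [← edist_dist, ENNReal.ofReal_inv_of_pos two_pos, ENNReal.ofReal_ofNat]
      exact hsep hx hy fun h => hxy (congrArg _ h)
    linarith [dist_eq_norm x y, (ENNReal.ofReal_lt_ofReal_iff_of_nonneg (by norm_num)).1 h]

variable (E) in
theorem packingNumber_closedBall_le [FiniteDimensional ℝ E] :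
    packingNumber 2⁻¹ (closedBall (0 : E) 1) ≤ (5 ^ finrank ℝ E : ℕ) := by
  refine iSup_le fun C => iSup_le fun hC => iSup_le fun hsep => ?_
  by_contra! hlt
  obtain ⟨t, htC, ht⟩ := Set.exists_subset_encard_eq (Order.add_one_le_of_lt hlt)
  have htfin : t.Finite :=
    Set.finite_of_encard_eq_coe (k := 5 ^ finrank ℝ E + 1) (by simpa using ht)
  lift t to Finset E using htfin
  have hcard := card_le_of_isSeparated_closedBall (htC.trans hC) (by simpa using hsep.subset htC)
  rw [Set.encard_coe_eq_coe_finsetCard] at ht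
  have ht' : t.card = 5 ^ finrank ℝ E + 1 := by exact_mod_cast ht
  omega

variable (E) in
theorem exists_finset_isCover_closedBall [FiniteDimensional ℝ E] :
    ∃ N : Finset E, N.card ≤ 5 ^ finrank ℝ E ∧ (∀ x ∈ N, ‖x‖ ≤ 1) ∧
      IsCover 2⁻¹ (closedBall (0 : E) 1) N := by
  have hle := packingNumber_closedBall_le E
  have htop : packingNumber 2⁻¹ (closedBall (0 : E) 1) ≠ ⊤ := ne_top_of_le_ne_top (by simp) hle
  have hcard := (encard_maximalSeparatedSet htop).trans_le hle
  have hsub := maximalSeparatedSet_subset (ε := 2⁻¹) (A := closedBall (0 : E) 1)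
  have hcover := isCover_maximalSeparatedSet htop
  lift maximalSeparatedSet 2⁻¹ (closedBall (0 : E) 1) to Finset E
    using Set.finite_of_encard_le_coe hcard with N
  rw [Set.encard_coe_eq_coe_finsetCard, Nat.cast_le] at hcard
  exact ⟨N, hcard, fun x hx => mem_closedBall_zero_iff.1 (hsub hx), hcover⟩

theorem exists_norm_le_of_isCover {N : Finset E}
    (hN : IsCover 2⁻¹ (closedBall (0 : E) 1) N) (f : E →L[ℝ] G) (x : E) :
    ∃ c ∈ N, ‖f x‖ ≤ 2 * ‖f c‖ * ‖x‖ := by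
  have hne : N.Nonempty := hN.nonempty ⟨0, by simp⟩
  obtain ⟨c, hc, hmax⟩ := N.exists_max_image (fun c => ‖f c‖) hne
  -- Approximating a unit vector by `N` costs `‖f‖ / 2`, which is absorbed on the left.
  have hf : ‖f‖ ≤ ‖f c‖ + ‖f‖ / 2 := by
    refine ContinuousLinearMap.opNorm_le_of_unit_norm (by positivity) fun y hy => ?_
    obtain ⟨d, hd, hyd⟩ := hN (mem_closedBall_zero_iff.2 hy.le)
    have hyd' : ‖y - d‖ ≤ 2⁻¹ := by
      rw [← dist_eq_norm]
      exact edist_le_coe.1 hyd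
    calc ‖f y‖ = ‖f d + f (y - d)‖ := by simp
      _ ≤ ‖f d‖ + ‖f (y - d)‖ := norm_add_le _ _
      _ ≤ ‖f c‖ + ‖f‖ * 2⁻¹ := add_le_add (hmax d hd) (f.le_opNorm_of_le hyd')
      _ = ‖f c‖ + ‖f‖ / 2 := by ring
  exact ⟨c, hc, (f.le_opNorm x).trans (by gcongr; linarith)⟩

theorem exists_norm_le_of_isCover₂ [FiniteDimensional ℝ E] [FiniteDimensional ℝ F]
    {N₁ : Finset E} {N₂ : Finset F}
    (h₁ : IsCover 2⁻¹ (closedBall (0 : E) 1) N₁) (h₂ : IsCover 2⁻¹ (closedBall (0 : F) 1) N₂)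
    (b : E →ₗ[ℝ] F →ₗ[ℝ] G) (x : E) (y : F) :
    ∃ c ∈ N₁, ∃ d ∈ N₂, ‖b x y‖ ≤ 4 * ‖b c d‖ * ‖x‖ * ‖y‖ := by
  obtain ⟨c, hc, hx⟩ := exists_norm_le_of_isCover h₁ (b.flip y).toContinuousLinearMap x
  obtain ⟨d, hd, hy⟩ := exists_norm_le_of_isCover h₂ (b c).toContinuousLinearMap y
  refine ⟨c, hc, d, hd, ?_⟩
  calc ‖b x y‖ ≤ 2 * ‖b c y‖ * ‖x‖ := hx
    _ ≤ 2 * (2 * ‖b c d‖ * ‖y‖) * ‖x‖ := by gcongr; exact hy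
    _ = 4 * ‖b c d‖ * ‖x‖ * ‖y‖ := by ring

end Coverings

section Clusterings

theorem stirlingSecond_add_le_pow (q d : ℕ) : Nat.stirlingSecond (q + d) q ≤ q ^ (2 * d) := by
  induction q generalizing d with
  | zero => cases d <;> simp
  | succ q ihq =>
    induction d with
    | zero => simp [Nat.stirlingSecond_self]
    | succ d ihd =>
      calc Nat.stirlingSecond (q + 1 + (d + 1)) (q + 1)
          = (q + 1) * Nat.stirlingSecond (q + 1 + d) (q + 1) +
              Nat.stirlingSecond (q + (d + 1)) q := by
            rw [← add_assoc, Nat.stirlingSecond_succ_succ, add_right_comm, ← add_assoc q d 1]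
        _ ≤ (q + 1) * (q + 1) ^ (2 * d) + q ^ (2 * (d + 1)) := by gcongr; exact ihq (d + 1)
        _ = (q + 1) ^ (2 * d + 1) + q ^ (2 * d + 1) * q := by ring
        _ ≤ (q + 1) ^ (2 * d + 1) + (q + 1) ^ (2 * d + 1) * q := by gcongr; omega
        _ = (q + 1) ^ (2 * (d + 1)) := by ring

/-- One labelling for each partition of `Fin p` into `q` nonempty groups, the groups being numbered
in the order in which they first appear. Going from `p` to `p + 1`, the new last element either
joins an existing group or opens the group with the largest label. -/
def clusterings : (p q : ℕ) → Finset (Fin p → Fin q)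
  | 0, 0 => {Fin.elim0}
  | 0, _ + 1 => ∅
  | _ + 1, 0 => ∅
  | p + 1, q + 1 =>
    (clusterings p (q + 1) ×ˢ Finset.univ).image
        (fun fa => (Fin.snoc fa.1 fa.2 : Fin (p + 1) → Fin (q + 1))) ∪
      (clusterings p q).image
        (fun f => (Fin.snoc (Fin.castSucc ∘ f) (Fin.last q) : Fin (p + 1) → Fin (q + 1)))

theorem card_clusterings_le (p q : ℕ) : (clusterings p q).card ≤ Nat.stirlingSecond p q := by
  induction p generalizing q with
  | zero => cases q <;> simp [clusterings]
  | succ p ih =>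
    cases q with
    | zero => simp [clusterings]
    | succ q =>
      rw [clusterings, Nat.stirlingSecond_succ_succ]
      refine (Finset.card_union_le _ _).trans (add_le_add ?_ (Finset.card_image_le.trans (ih q)))
      refine Finset.card_image_le.trans ?_
      rw [Finset.card_product, Finset.card_fin, mul_comm]
      exact Nat.mul_le_mul_left _ (ih (q + 1))

theorem card_clusterings_le_pow {p q : ℕ} (hqp : q ≤ p) :
    (clusterings p q).card ≤ q ^ (2 * (p - q)) := by
  obtain ⟨d, rfl⟩ := Nat.exists_eq_add_of_le hqp
  rw [Nat.add_sub_cancel_left]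
  exact (card_clusterings_le _ _).trans (stirlingSecond_add_le_pow q d)

theorem exists_mem_clusterings_comp_eq {α : Type*} {p q : ℕ} (hqp : q ≤ p) (g : Fin p → α)
    (hg : (Set.range g).ncard ≤ q) : ∃ f ∈ clusterings p q, ∃ h : Fin q → α, h ∘ f = g := by
  induction p generalizing q with
  | zero =>
    obtain rfl := Nat.le_zero.1 hqp
    exact ⟨Fin.elim0, by simp [clusterings], g, Subsingleton.elim _ _⟩
  | succ p ih =>
    cases q with
    | zero =>
      have := (Set.range_nonempty g).ncard_pos
      omega
    | succ q =>
      obtain ⟨g, x, rfl⟩ : ∃ g' x, g = Fin.snoc (α := fun _ => α) g' x :=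
        ⟨_, _, (Fin.snoc_init_self g).symm⟩
      rw [Fin.range_snoc] at hg
      rw [clusterings]
      by_cases hgq : (Set.range g).ncard ≤ q
      · obtain ⟨f, hf, h, rfl⟩ := ih (Nat.le_of_succ_le_succ hqp) g hgq
        refine ⟨_, Finset.mem_union_right _ (Finset.mem_image_of_mem _ hf), Fin.snoc h x, ?_⟩
        rw [Fin.comp_snoc, ← Function.comp_assoc, Fin.snoc_comp_castSucc, Fin.snoc_last]
      · have hx : x ∈ Set.range g := by
          by_contra hx
          rw [Set.ncard_insert_of_notMem hx] at hg
          omega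
        have hgp : (Set.range g).ncard ≤ p := by
          simpa using Set.ncard_image_le (f := g) Set.finite_univ
        rw [Set.insert_eq_of_mem hx] at hg
        obtain ⟨f, hf, h, rfl⟩ := ih (by omega) g hg
        obtain ⟨i, rfl⟩ := hx
        refine ⟨_, Finset.mem_union_left _
          (Finset.mem_image_of_mem _ (Finset.mk_mem_product hf (Finset.mem_univ (f i)))), h, ?_⟩
        rw [Fin.comp_snoc, Function.comp_apply]

end Clusterings

section Contraction

variable {E F : Type*} [NormedAddCommGroup E] [InnerProductSpace ℝ E]
  [NormedAddCommGroup F] [InnerProductSpace ℝ F] [FiniteDimensional ℝ F]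

theorem exists_linearIsometry_of_finrank_le [FiniteDimensional ℝ E]
    (h : finrank ℝ E ≤ finrank ℝ F) : Nonempty (E →ₗᵢ[ℝ] F) := by
  let b := stdOrthonormalBasis ℝ E
  let c := (stdOrthonormalBasis ℝ F).orthonormal.comp _ (Fin.castLE_injective h)
  refine ⟨(b.toBasis.constr ℝ (stdOrthonormalBasis ℝ F ∘ Fin.castLE h)).isometryOfOrthonormal
    (v := b.toBasis) (by simp) ?_⟩
  convert c using 1
  ext i
  simp

theorem exists_contraction_comp_adjoint_eq [CompleteSpace E] (S : Submodule ℝ E)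
    [FiniteDimensional ℝ S] (hS : finrank ℝ S ≤ finrank ℝ F) :
    ∃ R : F →L[ℝ] E, ‖R‖ ≤ 1 ∧ ∀ y ∈ S, R (R.adjoint y) = y := by
  obtain ⟨φ⟩ := exists_linearIsometry_of_finrank_le hS
  let Φ := φ.toContinuousLinearMap
  have hΦ (y : S) : Φ.adjoint (Φ y) = y :=
    DFunLike.congr_fun ((ContinuousLinearMap.norm_map_iff_adjoint_comp_self Φ).1 φ.norm_map) y
  refine ⟨S.subtypeL ∘L Φ.adjoint, ?_, fun y hy => ?_⟩
  · calc ‖S.subtypeL ∘L Φ.adjoint‖ ≤ ‖S.subtypeL‖ * ‖Φ.adjoint‖ :=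
          ContinuousLinearMap.opNorm_comp_le _ _
      _ ≤ 1 * 1 := by
          gcongr
          · exact S.norm_subtypeL_le
          · rw [LinearIsometryEquiv.norm_map]
            exact φ.norm_toContinuousLinearMap_le
      _ = 1 := one_mul 1
  · have hproj : S.subtypeL.adjoint y = ⟨y, hy⟩ := by
      rw [Submodule.adjoint_subtypeL]
      exact S.orthogonalProjectionOnto_mem_subspace_eq_self ⟨y, hy⟩
    rw [ContinuousLinearMap.adjoint_comp, ContinuousLinearMap.adjoint_adjoint]
    simp only [ContinuousLinearMap.comp_apply, hproj]
    exact congrArg Subtype.val (hΦ ⟨y, hy⟩)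

end Contraction

section Factorization

variable {n m k : ℕ}

theorem frobNorm_sq (A : Matrix (Fin n) (Fin m) ℝ) : frobNorm A ^ 2 = ∑ i, ∑ j, A i j ^ 2 :=
  Real.sq_sqrt (by positivity)

theorem frobNorm_nonneg (A : Matrix (Fin n) (Fin m) ℝ) : 0 ≤ frobNorm A :=
  Real.sqrt_nonneg _

theorem frobNorm_sq_eq_sum_norm_row (A : Matrix (Fin n) (Fin m) ℝ) :
    frobNorm A ^ 2 = ∑ i, ‖WithLp.toLp 2 (A i)‖ ^ 2 := by
  simp [frobNorm_sq, EuclideanSpace.real_norm_sq_eq]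

theorem rank_eq_finrank_span_toLp_row (A : Matrix (Fin n) (Fin m) ℝ) :
    A.rank = finrank ℝ (Submodule.span ℝ (Set.range fun i => WithLp.toLp 2 (A i))) := by
  rw [Matrix.rank_eq_finrank_span_row, ← LinearEquiv.finrank_map_eq
    (WithLp.linearEquiv 2 ℝ (Fin m → ℝ)).symm, Submodule.map_span, ← Set.range_comp]
  rfl

/-- The `n × k` matrices whose columns lie in `V`, stored by rows and equipped with the Frobenius
norm: the space of left factors of matrices of rank at most `k` with column space in `V`. -/
def columnsIn (V : Submodule ℝ (Fin n → ℝ)) (k : ℕ) :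
    Submodule ℝ (PiLp 2 fun _ : Fin n => EuclideanSpace ℝ (Fin k)) where
  carrier := {L | ∀ l, (fun i => L i l) ∈ V}
  add_mem' hL hL' l := V.add_mem (hL l) (hL' l)
  zero_mem' _ := V.zero_mem
  smul_mem' c _ hL l := V.smul_mem c (hL l)

theorem finrank_columnsIn_le (V : Submodule ℝ (Fin n → ℝ)) (k : ℕ) :
    finrank ℝ (columnsIn V k) ≤ k * finrank ℝ V := by
  let toColumns : columnsIn V k →ₗ[ℝ] Fin k → V :=
    { toFun := fun L l => ⟨fun i => L.1 i l, L.2 l⟩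
      map_add' := fun _ _ => rfl
      map_smul' := fun _ _ => rfl }
  have hinj : Function.Injective toColumns := fun L L' h => by
    ext i l
    exact congrFun (congrArg Subtype.val (congrFun h l)) i
  simpa [finrank_pi_fintype] using LinearMap.finrank_le_finrank_of_injective hinj

theorem finrank_continuousLinearMap (𝕜 E F : Type*) [NontriviallyNormedField 𝕜] [CompleteSpace 𝕜]
    [NormedAddCommGroup E] [NormedSpace 𝕜 E] [FiniteDimensional 𝕜 E]
    [NormedAddCommGroup F] [NormedSpace 𝕜 F] [FiniteDimensional 𝕜 F] :
    finrank 𝕜 (E →L[𝕜] F) = finrank 𝕜 E * finrank 𝕜 F := by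
  rw [← LinearMap.toContinuousLinearMap.finrank_eq, finrank_linearMap]

variable {V : Submodule ℝ (Fin n → ℝ)}

/-- The matrix product `L R`. The right factor is stored as the operator `x ↦ Rᵀ x`, so that it is
measured in the operator norm, while the left one is measured in the Frobenius norm. -/
def factorProd (L : columnsIn V k) (R : EuclideanSpace ℝ (Fin k) →L[ℝ] EuclideanSpace ℝ (Fin m)) :
    Matrix (Fin n) (Fin m) ℝ :=
  Matrix.of fun i => R (L.1 i)

theorem frobNorm_factorProd_le (L : columnsIn V k)
    (R : EuclideanSpace ℝ (Fin k) →L[ℝ] EuclideanSpace ℝ (Fin m)) :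
    frobNorm (factorProd L R) ≤ ‖R‖ * ‖L‖ := by
  refine le_of_sq_le_sq ?_ (by positivity)
  calc frobNorm (factorProd L R) ^ 2 = ∑ i, ‖R (L.1 i)‖ ^ 2 := frobNorm_sq_eq_sum_norm_row _
    _ ≤ ∑ i, (‖R‖ * ‖L.1 i‖) ^ 2 := by gcongr; exact R.le_opNorm _
    _ = (‖R‖ * ‖L‖) ^ 2 := by
      simp_rw [mul_pow, ← Finset.mul_sum, Submodule.coe_norm, PiLp.norm_sq_eq_of_L2]

theorem exists_factorProd_eq (A : Matrix (Fin n) (Fin m) ℝ)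
    (hV : LinearMap.range A.mulVecLin ≤ V) (hk : A.rank ≤ k) :
    ∃ (L : columnsIn V k) (R : EuclideanSpace ℝ (Fin k) →L[ℝ] EuclideanSpace ℝ (Fin m)),
      ‖L‖ ≤ frobNorm A ∧ ‖R‖ ≤ 1 ∧ factorProd L R = A := by
  let row : Fin n → EuclideanSpace ℝ (Fin m) := fun i => WithLp.toLp 2 (A i)
  obtain ⟨R, hR, hRrow⟩ := exists_contraction_comp_adjoint_eq (F := EuclideanSpace ℝ (Fin k))
    (Submodule.span ℝ (Set.range row)) (by simpa [← rank_eq_finrank_span_toLp_row, row] using hk)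
  let L : PiLp 2 fun _ : Fin n => EuclideanSpace ℝ (Fin k) :=
    WithLp.toLp 2 fun i => R.adjoint (row i)
  have hcol (i : Fin n) (l : Fin k) : L i l = A.mulVecLin (R (EuclideanSpace.single l 1)) i :=
    calc L i l = inner ℝ (EuclideanSpace.single l 1) (R.adjoint (row i)) := by
          rw [EuclideanSpace.inner_single_left, map_one, one_mul]
      _ = inner ℝ (R (EuclideanSpace.single l 1)) (row i) := R.adjoint_inner_right _ _
      _ = A.mulVecLin (R (EuclideanSpace.single l 1)) i := by
          simp [row, PiLp.inner_apply, Matrix.mulVec, dotProduct]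
  refine ⟨⟨L, fun l => ?_⟩, R, ?_, hR, ?_⟩
  · simp only [hcol]
    exact hV ⟨_, rfl⟩
  · refine le_of_sq_le_sq ?_ (frobNorm_nonneg _)
    rw [frobNorm_sq_eq_sum_norm_row, Submodule.coe_norm, PiLp.norm_sq_eq_of_L2]
    gcongr with i
    refine (R.adjoint.le_opNorm _).trans (mul_le_of_le_one_left (norm_nonneg _) ?_)
    rwa [LinearIsometryEquiv.norm_map]
  · ext i j
    exact congrArg (fun y : EuclideanSpace ℝ (Fin m) => y j)
      (hRrow (row i) (Submodule.subset_span ⟨i, rfl⟩))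

/-- The bilinear form `(L, R) ↦ ⟨A, L R⟩`, to be evaluated on coverings of the unit balls of the two
factor spaces. -/
noncomputable def factorForm (V : Submodule ℝ (Fin n → ℝ)) (k : ℕ)
    (A : Matrix (Fin n) (Fin m) ℝ) :
    columnsIn V k →ₗ[ℝ] (EuclideanSpace ℝ (Fin k) →L[ℝ] EuclideanSpace ℝ (Fin m)) →ₗ[ℝ] ℝ :=
  LinearMap.mk₂ ℝ (fun L R => frobInner A (factorProd L R))
    (fun L L' R => by simp [frobInner, factorProd, mul_add, Finset.sum_add_distrib])
    (fun c L R => by simp [frobInner, factorProd, Finset.mul_sum, mul_left_comm])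
    (fun L R R' => by simp [frobInner, factorProd, mul_add, Finset.sum_add_distrib])
    (fun c L R => by simp [frobInner, factorProd, Finset.mul_sum, mul_left_comm])

end Factorization

section NormingSets

variable {n p m q r k : ℕ}

/-- `N` is a set of matrices in the Frobenius unit ball which is `4`-norming for `S`: a linear
functional `⟨A, ·⟩` which is small on `N` is small, relative to the Frobenius norm, on `S`. -/
structure IsNormingSet (N : Finset (Matrix (Fin n) (Fin m) ℝ))
    (S : Set (Matrix (Fin n) (Fin m) ℝ)) : Prop where
  frobNorm_le_one : ∀ D ∈ N, frobNorm D ≤ 1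
  exists_frobInner_le : ∀ A, ∀ Δ ∈ S, ∃ D ∈ N, frobInner A Δ ≤ 4 * |frobInner A D| * frobNorm Δ

theorem IsNormingSet.mono {N : Finset (Matrix (Fin n) (Fin m) ℝ)}
    {S T : Set (Matrix (Fin n) (Fin m) ℝ)} (hN : IsNormingSet N T) (hST : S ⊆ T) :
    IsNormingSet N S :=
  ⟨hN.frobNorm_le_one, fun A Δ hΔ => hN.exists_frobInner_le A Δ (hST hΔ)⟩

theorem isNormingSet_biUnion [DecidableEq (Matrix (Fin n) (Fin m) ℝ)] {ι : Type*} {I : Finset ι}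
    {N : ι → Finset (Matrix (Fin n) (Fin m) ℝ)} {S : ι → Set (Matrix (Fin n) (Fin m) ℝ)}
    (h : ∀ i ∈ I, IsNormingSet (N i) (S i)) : IsNormingSet (I.biUnion N) (⋃ i ∈ I, S i) where
  frobNorm_le_one D hD := by
    obtain ⟨i, hi, hD⟩ := Finset.mem_biUnion.1 hD
    exact (h i hi).frobNorm_le_one D hD
  exists_frobInner_le A Δ hΔ := by
    obtain ⟨i, hi, hΔ⟩ := Set.mem_iUnion₂.1 hΔ
    obtain ⟨D, hD, hle⟩ := (h i hi).exists_frobInner_le A Δ hΔ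
    exact ⟨D, Finset.mem_biUnion.2 ⟨i, hi, hD⟩, hle⟩

theorem exists_isNormingSet_rank_le (V : Submodule ℝ (Fin n → ℝ)) (k m : ℕ) :
    ∃ N : Finset (Matrix (Fin n) (Fin m) ℝ), N.card ≤ 5 ^ (k * (finrank ℝ V + m)) ∧
      IsNormingSet N {Δ | LinearMap.range Δ.mulVecLin ≤ V ∧ Δ.rank ≤ k} := by
  classical
  obtain ⟨N₁, hcard₁, hnorm₁, hN₁⟩ := exists_finset_isCover_closedBall (columnsIn V k)
  obtain ⟨N₂, hcard₂, hnorm₂, hN₂⟩ := exists_finset_isCover_closedBall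
    (EuclideanSpace ℝ (Fin k) →L[ℝ] EuclideanSpace ℝ (Fin m))
  refine ⟨Finset.image₂ factorProd N₁ N₂, ?_, ?_, ?_⟩
  · calc (Finset.image₂ factorProd N₁ N₂).card ≤ N₁.card * N₂.card := Finset.card_image₂_le _ _ _
      _ ≤ 5 ^ (k * finrank ℝ V) * 5 ^ (k * m) := by
        rw [finrank_continuousLinearMap, finrank_euclideanSpace_fin,
          finrank_euclideanSpace_fin] at hcard₂
        gcongr
        exact hcard₁.trans (Nat.pow_le_pow_right (by norm_num) (finrank_columnsIn_le V k))
      _ = 5 ^ (k * (finrank ℝ V + m)) := by rw [← pow_add, mul_add]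
  · rw [Finset.forall_mem_image₂]
    exact fun L hL R hR => (frobNorm_factorProd_le L R).trans
      (mul_le_one₀ (hnorm₂ R hR) (norm_nonneg L) (hnorm₁ L hL))
  · rintro A Δ ⟨hV, hk⟩
    obtain ⟨L, R, hL, hR, rfl⟩ := exists_factorProd_eq Δ hV hk
    obtain ⟨c, hc, d, hd, hle⟩ := exists_norm_le_of_isCover₂ hN₁ hN₂ (factorForm V k A) L R
    refine ⟨_, Finset.mem_image₂_of_mem hc hd, ?_⟩
    set a := frobInner A (factorProd c d)
    have hLR := frobNorm_nonneg (factorProd L R)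
    calc frobInner A (factorProd L R) ≤ |frobInner A (factorProd L R)| := le_abs_self _
      _ ≤ 4 * |a| * ‖L‖ * ‖R‖ := hle
      _ ≤ 4 * |a| * frobNorm (factorProd L R) * 1 := by gcongr
      _ = 4 * |a| * frobNorm (factorProd L R) := mul_one _

theorem range_mulVecLin_sub_le {ι κ R : Type*} [Fintype κ] [CommRing R] (A B : Matrix ι κ R) :
    LinearMap.range (A - B).mulVecLin ≤
      LinearMap.range A.mulVecLin ⊔ LinearMap.range B.mulVecLin := by
  rintro _ ⟨x, rfl⟩
  rw [Matrix.mulVecLin_apply, Matrix.sub_mulVec]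
  exact Submodule.sub_mem _ (Submodule.mem_sup_left ⟨x, rfl⟩) (Submodule.mem_sup_right ⟨x, rfl⟩)

theorem rank_sub_le {ι κ K : Type*} [Finite ι] [Fintype κ] [Field K] (A B : Matrix ι κ K) :
    (A - B).rank ≤ A.rank + B.rank :=
  (Submodule.finrank_mono (range_mulVecLin_sub_le A B)).trans
    (Submodule.finrank_add_le_finrank_add_finrank _ _)

/-- The space of all `X b` where `b` is constant on the groups of the labelling `f`: it contains the
columns of `X B` for every `B` whose rows are clustered by `f`. -/
def clusterSpace (X : Matrix (Fin n) (Fin p) ℝ) (f : Fin p → Fin q) : Submodule ℝ (Fin n → ℝ) :=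
  (LinearMap.range (LinearMap.funLeft ℝ ℝ f)).map X.mulVecLin

theorem finrank_clusterSpace_le (X : Matrix (Fin n) (Fin p) ℝ) (f : Fin p → Fin q) :
    finrank ℝ (clusterSpace X f) ≤ min q X.rank := by
  refine le_min ((Submodule.finrank_map_le _ _).trans ?_)
    (Submodule.finrank_mono LinearMap.map_le_range)
  exact (LinearMap.finrank_range_le _).trans_eq (by simp)

theorem exists_range_mulVecLin_mul_le_clusterSpace (hqp : q ≤ p) (X : Matrix (Fin n) (Fin p) ℝ)
    {B : Matrix (Fin p) (Fin m) ℝ} (hB : numDistinctRows B ≤ q) :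
    ∃ f ∈ clusterings p q, LinearMap.range (X * B).mulVecLin ≤ clusterSpace X f := by
  obtain ⟨f, hf, h, hfB⟩ := exists_mem_clusterings_comp_eq hqp B.row hB
  refine ⟨f, hf, ?_⟩
  rw [Matrix.mulVecLin_mul, LinearMap.range_comp]
  refine Submodule.map_mono ?_
  rintro _ ⟨x, rfl⟩
  refine ⟨fun a => h a ⬝ᵥ x, funext fun i => ?_⟩
  exact congrArg (· ⬝ᵥ x) (congrFun hfB i)

theorem exists_isNormingSet_constraintSet (hqp : q ≤ p) (X : Matrix (Fin n) (Fin p) ℝ)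
    {Bstar : Matrix (Fin p) (Fin m) ℝ} (hBstar : Bstar ∈ constraintSet p m q r) :
    ∃ N : Finset (Matrix (Fin n) (Fin m) ℝ),
      N.card ≤ q ^ (2 * (p - q)) * 5 ^ (2 * r * (2 * min q X.rank + m)) ∧
        IsNormingSet N ((fun B => X * B - X * Bstar) '' constraintSet p m q r) := by
  classical
  obtain ⟨g, -, hg⟩ := exists_range_mulVecLin_mul_le_clusterSpace hqp X hBstar.1
  let V : (Fin p → Fin q) → Submodule ℝ (Fin n → ℝ) := fun f => clusterSpace X f ⊔ clusterSpace X g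
  have hV (f : Fin p → Fin q) : finrank ℝ (V f) ≤ 2 * min q X.rank :=
    calc finrank ℝ (V f) ≤ finrank ℝ (clusterSpace X f) + finrank ℝ (clusterSpace X g) :=
          Submodule.finrank_add_le_finrank_add_finrank _ _
      _ ≤ min q X.rank + min q X.rank :=
          add_le_add (finrank_clusterSpace_le X f) (finrank_clusterSpace_le X g)
      _ = 2 * min q X.rank := (two_mul _).symm
  choose N hcard hN using fun f => exists_isNormingSet_rank_le (V f) (2 * r) m
  refine ⟨(clusterings p q).biUnion N, ?_, (isNormingSet_biUnion fun f _ => hN f).mono ?_⟩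
  · have hcard' (f) : (N f).card ≤ 5 ^ (2 * r * (2 * min q X.rank + m)) :=
      (hcard f).trans (Nat.pow_le_pow_right (by norm_num) (by gcongr; exact hV f))
    exact (Finset.card_biUnion_le_card_mul _ _ _ fun f _ => hcard' f).trans
      (Nat.mul_le_mul_right _ (card_clusterings_le_pow hqp))
  · rintro _ ⟨B, hB, rfl⟩
    obtain ⟨f, hf, hBf⟩ := exists_range_mulVecLin_mul_le_clusterSpace hqp X hB.1
    refine Set.mem_iUnion₂.2 ⟨f, hf, ?_, ?_⟩
    · exact (range_mulVecLin_sub_le _ _).trans (sup_le_sup hBf hg)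
    · calc (X * B - X * Bstar).rank = (X * (B - Bstar)).rank := by rw [Matrix.mul_sub]
        _ ≤ (B - Bstar).rank := Matrix.rank_mul_le_right _ _
        _ ≤ B.rank + Bstar.rank := rank_sub_le B Bstar
        _ ≤ 2 * r := (add_le_add hB.2 hBstar.2).trans_eq (two_mul r).symm

end NormingSets

section MaximalInequality

variable {Ω ι : Type*} [MeasurableSpace Ω] {μ : Measure Ω}

theorem lintegral_exp_sq_le_two_of_psi2Norm_lt {Z : Ω → ℝ} {t : ℝ}
    (hZ : psi2Norm μ Z < ENNReal.ofReal t) :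
    ∫⁻ ω, ENNReal.ofReal (Real.exp ((Z ω / t) ^ 2)) ∂μ ≤ 2 := by
  simp only [psi2Norm, iInf_lt_iff] at hZ
  obtain ⟨u, hu, hle, hut⟩ := hZ
  have hut : u < t := (ENNReal.ofReal_lt_ofReal_iff_of_nonneg hu.le).1 hut
  refine (lintegral_mono fun ω => ENNReal.ofReal_le_ofReal (Real.exp_le_exp.2 ?_)).trans hle
  rw [div_pow, div_pow]
  gcongr

theorem integrable_of_lintegral_ofReal_le {g : Ω → ℝ} {b : ℝ} (hg : AEMeasurable g μ)
    (hg0 : 0 ≤ᵐ[μ] g) (h : ∫⁻ ω, ENNReal.ofReal (g ω) ∂μ ≤ ENNReal.ofReal b) : Integrable g μ :=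
  ⟨hg.aestronglyMeasurable, (hasFiniteIntegral_iff_ofReal hg0).2
    (h.trans_lt ENNReal.ofReal_lt_top)⟩

theorem integral_le_of_lintegral_ofReal_le {g : Ω → ℝ} {b : ℝ} (hg : AEMeasurable g μ)
    (hg0 : 0 ≤ᵐ[μ] g) (hb : 0 ≤ b) (h : ∫⁻ ω, ENNReal.ofReal (g ω) ∂μ ≤ ENNReal.ofReal b) :
    ∫ ω, g ω ∂μ ≤ b := by
  rw [integral_eq_lintegral_of_nonneg_ae hg0 hg.aestronglyMeasurable]
  exact ENNReal.toReal_le_of_le_ofReal hb h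

-- The tangent line of `exp` at `log K` replaces a maximum over `K` terms by an average.
theorem le_log_add_exp_div {K : ℝ} (hK : 0 < K) (x : ℝ) :
    x ≤ Real.log K - 1 + Real.exp x / K := by
  have h := Real.add_one_le_exp (x - Real.log K)
  rw [Real.exp_sub, Real.exp_log hK] at h
  linarith

theorem integrable_and_integral_le_of_lintegral_exp_le [IsProbabilityMeasure μ]
    {N : Finset ι} {Z : ι → Ω → ℝ} {f : Ω → ℝ} {a b : ℝ} (ha : 0 ≤ a) (hb : 0 ≤ b)
    (hZm : ∀ i ∈ N, AEMeasurable (Z i) μ)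
    (hZ : ∀ i ∈ N, ∫⁻ ω, ENNReal.ofReal (Real.exp (Z i ω)) ∂μ ≤ ENNReal.ofReal b)
    (hfm : AEStronglyMeasurable f μ) (hf0 : 0 ≤ᵐ[μ] f)
    (hf : ∀ᵐ ω ∂μ, ∃ i ∈ N, f ω ≤ a * Z i ω) :
    Integrable f μ ∧ ∫ ω, f ω ∂μ ≤ a * (Real.log N.card - 1 + b) := by
  have hcard : (0 : ℝ) < N.card := by
    obtain ⟨ω, i, hi, -⟩ := hf.exists
    exact_mod_cast Finset.card_pos.2 ⟨i, hi⟩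
  have hexpm (i) (hi : i ∈ N) : AEMeasurable (fun ω => Real.exp (Z i ω)) μ :=
    Real.measurable_exp.comp_aemeasurable (hZm i hi)
  have hexp0 (i) (ω) : 0 ≤ Real.exp (Z i ω) := (Real.exp_pos _).le
  have hexpi (i) (hi : i ∈ N) : Integrable (fun ω => Real.exp (Z i ω)) μ :=
    integrable_of_lintegral_ofReal_le (hexpm i hi) (ae_of_all _ (hexp0 i)) (hZ i hi)
  let g : Ω → ℝ := fun ω => a * (Real.log N.card - 1 + (∑ i ∈ N, Real.exp (Z i ω)) / N.card)
  have hfg : f ≤ᵐ[μ] g := by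
    filter_upwards [hf] with ω ⟨i, hi, hle⟩
    refine hle.trans (mul_le_mul_of_nonneg_left ((le_log_add_exp_div hcard _).trans ?_) ha)
    gcongr
    exact Finset.single_le_sum (f := fun i => Real.exp (Z i ω)) (fun j _ => hexp0 j ω) hi
  have hsum : Integrable (fun ω => (∑ i ∈ N, Real.exp (Z i ω)) / N.card) μ :=
    (integrable_finsetSum _ hexpi).div_const _
  have hg : Integrable g μ := ((integrable_const _).add hsum).const_mul _
  have hmean : ∫ ω, (∑ i ∈ N, Real.exp (Z i ω)) / N.card ∂μ ≤ b := by
    rw [integral_div, integral_finsetSum _ hexpi, div_le_iff₀' hcard, ← nsmul_eq_mul]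
    exact Finset.sum_le_card_nsmul _ _ _ fun i hi =>
      integral_le_of_lintegral_ofReal_le (hexpm i hi) (ae_of_all _ (hexp0 i)) hb (hZ i hi)
  refine ⟨hg.mono' hfm ?_, (integral_mono_of_nonneg hf0 hg hfg).trans ?_⟩
  · filter_upwards [hf0, hfg] with ω h0 hle
    exact (Real.norm_of_nonneg h0).trans_le hle
  · rw [integral_const_mul, integral_add (integrable_const _) hsum, integral_const,
      probReal_univ, one_smul]
    gcongr

theorem integrable_and_integral_le_of_psi2Norm_le [IsProbabilityMeasure μ] {N : Finset ι}
    {Z : ι → Ω → ℝ} {f : Ω → ℝ} {c s : ℝ} (hc : 0 ≤ c) (hs : 0 ≤ s)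
    (hZm : ∀ i ∈ N, AEMeasurable (Z i) μ)
    (hZ : ∀ i ∈ N, psi2Norm μ (Z i) ≤ ENNReal.ofReal s)
    (hfm : AEStronglyMeasurable f μ) (hf0 : 0 ≤ᵐ[μ] f)
    (hf : ∀ᵐ ω ∂μ, ∃ i ∈ N, f ω ≤ c * Z i ω ^ 2) :
    Integrable f μ ∧ ∫ ω, f ω ∂μ ≤ c * s ^ 2 * (Real.log N.card + 1) := by
  -- The infimum in `psi2Norm` need not be attained, hence a bound at every `t > s`, then `t ↓ s`.
  have hlt (t : ℝ) (hst : s < t) :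
      Integrable f μ ∧ ∫ ω, f ω ∂μ ≤ c * t ^ 2 * (Real.log N.card - 1 + 2) := by
    have ht : 0 < t := hs.trans_lt hst
    have hexp (i) (hi : i ∈ N) : ∫⁻ ω, ENNReal.ofReal (Real.exp ((Z i ω / t) ^ 2)) ∂μ ≤ 2 :=
      lintegral_exp_sq_le_two_of_psi2Norm_lt
        ((hZ i hi).trans_lt ((ENNReal.ofReal_lt_ofReal_iff ht).2 hst))
    refine integrable_and_integral_le_of_lintegral_exp_le (Z := fun i ω => (Z i ω / t) ^ 2)
      (by positivity) zero_le_two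
      (fun i hi => ((hZm i hi).div_const t).pow_const 2)
      (fun i hi => (hexp i hi).trans_eq (by simp)) hfm hf0 ?_
    filter_upwards [hf] with ω ⟨i, hi, hle⟩
    refine ⟨i, hi, hle.trans_eq ?_⟩
    field_simp
  refine ⟨(hlt (s + 1) (lt_add_one s)).1, ?_⟩
  have hcont : Continuous fun t : ℝ => c * t ^ 2 * (Real.log N.card - 1 + 2) := by fun_prop
  have hlim : ∫ ω, f ω ∂μ ≤ c * s ^ 2 * (Real.log N.card - 1 + 2) :=
    ge_of_tendsto ((hcont.tendsto s).mono_left (nhdsWithin_le_nhds (s := Set.Ioi s)))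
      (Filter.eventually_of_mem self_mem_nhdsWithin fun t ht => (hlt t ht).2)
  exact hlim.trans_eq (by ring)

end MaximalInequality

section ErrorBound

variable {Ω : Type*} [MeasurableSpace Ω] {μ : Measure Ω} {n p m q r : ℕ}

theorem aemeasurable_frobInner {E : Ω → Matrix (Fin n) (Fin m) ℝ}
    (hE : ∀ i j, AEMeasurable (fun ω => E ω i j) μ) (D : Matrix (Fin n) (Fin m) ℝ) :
    AEMeasurable (fun ω => frobInner (E ω) D) μ :=
  Finset.aemeasurable_fun_sum _ fun i _ => Finset.aemeasurable_fun_sum _ fun j _ =>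
    (hE i j).mul_const _

theorem aemeasurable_frobNorm_sq {Δ : Ω → Matrix (Fin n) (Fin m) ℝ}
    (hΔ : ∀ i j, AEMeasurable (fun ω => Δ ω i j) μ) :
    AEMeasurable (fun ω => frobNorm (Δ ω) ^ 2) μ := by
  simp only [frobNorm_sq]
  exact Finset.aemeasurable_fun_sum _ fun i _ => Finset.aemeasurable_fun_sum _ fun j _ =>
    (hΔ i j).pow_const 2

theorem aemeasurable_mul_sub_apply (X : Matrix (Fin n) (Fin p) ℝ) (Θ : Matrix (Fin n) (Fin m) ℝ)
    {B : Ω → Matrix (Fin p) (Fin m) ℝ} (hB : ∀ i j, AEMeasurable (fun ω => B ω i j) μ)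
    (i : Fin n) (j : Fin m) : AEMeasurable (fun ω => (X * B ω - Θ) i j) μ := by
  simp only [Matrix.sub_apply, Matrix.mul_apply]
  exact (Finset.aemeasurable_fun_sum _ fun l _ => (hB l j).const_mul _).sub_const _

theorem IsNormingSet.exists_frobNorm_sq_le {N : Finset (Matrix (Fin n) (Fin m) ℝ)}
    {S : Set (Matrix (Fin n) (Fin m) ℝ)} (hN : IsNormingSet N S) {A Δ : Matrix (Fin n) (Fin m) ℝ}
    {δ : ℝ} (hδ : 0 < δ) (hΔ : Δ ∈ S) (h : δ * (frobNorm Δ ^ 2 / 2) ≤ frobInner A Δ) :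
    ∃ D ∈ N, frobNorm Δ ^ 2 ≤ 64 / δ ^ 2 * frobInner A D ^ 2 := by
  obtain ⟨D, hD, hle⟩ := hN.exists_frobInner_le A Δ hΔ
  refine ⟨D, hD, ?_⟩
  have hΔ0 := frobNorm_nonneg Δ
  have hbound : frobNorm Δ ≤ 8 / δ * |frobInner A D| := by
    rcases hΔ0.eq_or_lt with h0 | hpos
    · rw [← h0]
      positivity
    · rw [div_mul_eq_mul_div, le_div_iff₀ hδ]
      exact le_of_mul_le_mul_right (by linarith) hpos
  calc frobNorm Δ ^ 2 ≤ (8 / δ * |frobInner A D|) ^ 2 := by gcongr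
    _ = 64 / δ ^ 2 * frobInner A D ^ 2 := by rw [mul_pow, sq_abs]; ring

theorem IsNormingSet.integrable_and_integral_frobNorm_sq_le [IsProbabilityMeasure μ]
    {N : Finset (Matrix (Fin n) (Fin m) ℝ)} {S : Set (Matrix (Fin n) (Fin m) ℝ)}
    (hN : IsNormingSet N S) {E Δ : Ω → Matrix (Fin n) (Fin m) ℝ} {σ δ : ℝ} (hσ : 0 ≤ σ)
    (hδ : 0 < δ) (hEm : ∀ i j, AEMeasurable (fun ω => E ω i j) μ)
    (hE : ∀ A, psi2Norm μ (fun ω => frobInner (E ω) A) ≤ ENNReal.ofReal (σ * frobNorm A))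
    (hΔm : ∀ i j, AEMeasurable (fun ω => Δ ω i j) μ) (hΔ : ∀ᵐ ω ∂μ, Δ ω ∈ S)
    (h : ∀ᵐ ω ∂μ, δ * (frobNorm (Δ ω) ^ 2 / 2) ≤ frobInner (E ω) (Δ ω)) :
    Integrable (fun ω => frobNorm (Δ ω) ^ 2) μ ∧
      ∫ ω, frobNorm (Δ ω) ^ 2 ∂μ ≤ 64 / δ ^ 2 * σ ^ 2 * (Real.log N.card + 1) := by
  refine integrable_and_integral_le_of_psi2Norm_le (N := N) (Z := fun D ω => frobInner (E ω) D)
    (by positivity) hσ (fun D _ => aemeasurable_frobInner hEm D) (fun D hD => ?_)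
    (aemeasurable_frobNorm_sq hΔm).aestronglyMeasurable (ae_of_all _ fun ω => sq_nonneg _) ?_
  · exact (hE D).trans (ENNReal.ofReal_le_ofReal
      (mul_le_of_le_one_right hσ (hN.frobNorm_le_one D hD)))
  · filter_upwards [hΔ, h] with ω hω hle
    exact hN.exists_frobNorm_sq_le hδ hω hle

theorem log_natCast_le_of_le_pow_mul_pow {K a b c d : ℕ} (h : K ≤ a ^ c * b ^ d) :
    Real.log K ≤ c * Real.log a + d * Real.log b := by
  rcases Nat.eq_zero_or_pos K with rfl | hK
  · have := Real.log_natCast_nonneg a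
    have := Real.log_natCast_nonneg b
    simp only [Nat.cast_zero, Real.log_zero]
    positivity
  · have hac : a ^ c ≠ 0 := fun h0 => by simp [h0, hK.ne'] at h
    have hbd : b ^ d ≠ 0 := fun h0 => by simp [h0, hK.ne'] at h
    calc Real.log K ≤ Real.log ((a : ℝ) ^ c * (b : ℝ) ^ d) :=
          Real.log_le_log (by exact_mod_cast hK) (by exact_mod_cast h)
      _ = c * Real.log a + d * Real.log b := by
          rw [Real.log_mul (by exact_mod_cast hac) (by exact_mod_cast hbd), Real.log_pow,
            Real.log_pow]

theorem log_card_add_one_le {K s : ℕ} (hqp : q ≤ p)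
    (hK : K ≤ q ^ (2 * (p - q)) * 5 ^ (2 * r * (2 * s + m))) :
    Real.log K + 1 ≤ 16 * ((s + m) * r + (p - q) * Real.log q + 1) := by
  have hlog5 : Real.log (5 : ℕ) ≤ 4 :=
    (Real.log_le_sub_one_of_pos (by norm_num)).trans (by norm_num)
  have hlogq : 0 ≤ ((p : ℝ) - q) * Real.log q :=
    mul_nonneg (sub_nonneg.2 (by exact_mod_cast hqp)) (Real.log_natCast_nonneg q)
  calc Real.log K + 1
      ≤ (2 * (p - q) : ℕ) * Real.log q + (2 * r * (2 * s + m) : ℕ) * Real.log (5 : ℕ) + 1 := by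
        gcongr
        exact log_natCast_le_of_le_pow_mul_pow hK
    _ ≤ (2 * (p - q) : ℕ) * Real.log q + (2 * r * (2 * s + m) : ℕ) * 4 + 1 := by gcongr
    _ = 2 * ((p - q) * Real.log q) + (16 * (s * r) + 8 * (m * r)) + 1 := by
        push_cast [hqp]
        ring
    _ ≤ 16 * ((p - q) * Real.log q) + (16 * (s * r) + 16 * (m * r)) + 16 := by
        gcongr <;> norm_num
    _ = 16 * ((s + m) * r + (p - q) * Real.log q + 1) := by ring

theorem IsOptimalCRL.basic_inequality {l₀ : Matrix (Fin n) (Fin m) ℝ → Matrix (Fin n) (Fin m) ℝ → ℝ}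
    {X : Matrix (Fin n) (Fin p) ℝ} {Y : Matrix (Fin n) (Fin m) ℝ}
    {B Bstar : Matrix (Fin p) (Fin m) ℝ} {δ : ℝ} (hopt : IsOptimalCRL l₀ X Y q r B)
    (hBstar : Bstar ∈ constraintSet p m q r)
    (hconv : δ * D2 (X * B) (X * Bstar) ≤ bregman (fun Θ => l₀ Θ Y) (X * B) (X * Bstar)) :
    δ * D2 (X * B) (X * Bstar) ≤
      frobInner (effectiveNoise l₀ X Bstar Y) (X * B - X * Bstar) := by
  have hmin : l₀ (X * B) Y ≤ l₀ (X * Bstar) Y := hopt.2 hBstar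
  have hneg : frobInner (effectiveNoise l₀ X Bstar Y) (X * B - X * Bstar) =
      -frobInner (grad (fun Θ => l₀ Θ Y) (X * Bstar)) (X * B - X * Bstar) := by
    simp [frobInner, effectiveNoise]
  rw [bregman] at hconv
  linarith

end ErrorBound

end CRL

open CRL in
theorem theorem3_general {Ω : Type*} [MeasurableSpace Ω] {μ : Measure Ω} [IsProbabilityMeasure μ]
    {n p m q r : ℕ} {X : Matrix (Fin n) (Fin p) ℝ} {Bstar : Matrix (Fin p) (Fin m) ℝ}
    {E : Ω → Matrix (Fin n) (Fin m) ℝ} {Bhat : Ω → Matrix (Fin p) (Fin m) ℝ} {σ δ : ℝ}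
    (hσ : 0 ≤ σ) (hδ : 0 < δ) (hEm : ∀ i j, AEMeasurable (fun ω => E ω i j) μ)
    (hE : ∀ A, psi2Norm μ (fun ω => frobInner (E ω) A) ≤ ENNReal.ofReal (σ * frobNorm A))
    (hBstar : Bstar ∈ constraintSet p m q r) (hqp : q ≤ p)
    (hBm : ∀ i j, AEMeasurable (fun ω => Bhat ω i j) μ)
    (hB : ∀ᵐ ω ∂μ, Bhat ω ∈ constraintSet p m q r)
    (hbasic : ∀ᵐ ω ∂μ,
      δ * D2 (X * Bhat ω) (X * Bstar) ≤ frobInner (E ω) (X * Bhat ω - X * Bstar)) :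
    Integrable (fun ω => frobNorm (X * Bhat ω - X * Bstar) ^ 2) μ ∧
      ∫ ω, frobNorm (X * Bhat ω - X * Bstar) ^ 2 ∂μ ≤
        1024 * (1 / δ ^ 2 *
          (σ ^ 2 * (((min q X.rank : ℕ) : ℝ) + m) * r
            + σ ^ 2 * ((p : ℝ) - q) * Real.log q + σ ^ 2)) := by
  obtain ⟨N, hcard, hN⟩ := exists_isNormingSet_constraintSet hqp X hBstar
  obtain ⟨hint, hle⟩ := hN.integrable_and_integral_frobNorm_sq_le hσ hδ hEm hE
    (aemeasurable_mul_sub_apply X (X * Bstar) hBm)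
    (hB.mono fun ω hω => Set.mem_image_of_mem _ hω) hbasic
  refine ⟨hint, hle.trans ?_⟩
  calc 64 / δ ^ 2 * σ ^ 2 * (Real.log N.card + 1)
      ≤ 64 / δ ^ 2 * σ ^ 2 *
          (16 * ((((min q X.rank : ℕ) : ℝ) + m) * r + ((p : ℝ) - q) * Real.log q + 1)) := by
        gcongr
        exact log_card_add_one_le hqp hcard
    _ = _ := by ring

theorem theorem3 :
    ∃ C : ℝ, 0 < C ∧
      ∀ {Ω : Type*} [MeasurableSpace Ω] (μ : Measure Ω) [IsProbabilityMeasure μ]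
        (n p m q r : ℕ)
        (l₀ : Matrix (Fin n) (Fin m) ℝ → Matrix (Fin n) (Fin m) ℝ → ℝ)
        (X : Matrix (Fin n) (Fin p) ℝ)
        (Y : Ω → Matrix (Fin n) (Fin m) ℝ)
        (Bstar : Matrix (Fin p) (Fin m) ℝ)
        (Bhat : Ω → Matrix (Fin p) (Fin m) ℝ)
        (σ δ : ℝ),
        0 ≤ σ → 0 < δ →
        -- the loss is differentiable in the systematic component
        (∀ᵐ ω ∂μ, Differentiable ℝ fun Θ => l₀ Θ (Y ω)) →
        -- the effective noise is sub-Gaussian with mean zero and scale bounded by `σ`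
        CRL.IsSubGaussianNoise μ (fun ω => CRL.effectiveNoise l₀ X Bstar (Y ω)) σ →
        -- `r ≥ r*`, `q ≥ q*`, and there are at most as many groups as features
        Bstar.rank ≤ r → CRL.numDistinctRows Bstar ≤ q → q ≤ p →
        -- `Bhat` is a (measurable) optimal CRL solution
        (∀ i j, AEMeasurable (fun ω => Bhat ω i j) μ) →
        (∀ᵐ ω ∂μ, CRL.IsOptimalCRL l₀ X (Y ω) q r (Bhat ω)) →
        -- restricted strong convexity
        (∀ᵐ ω ∂μ, ∀ B₁ ∈ CRL.constraintSet p m q r, ∀ B₂ ∈ CRL.constraintSet p m q r,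
          δ * CRL.D2 (X * B₁) (X * B₂) ≤
            CRL.bregman (fun Θ => l₀ Θ (Y ω)) (X * B₁) (X * B₂)) →
        Integrable (fun ω => CRL.frobNorm (X * Bhat ω - X * Bstar) ^ 2) μ ∧
        ∫ ω, CRL.frobNorm (X * Bhat ω - X * Bstar) ^ 2 ∂μ ≤
          C * (1 / δ ^ 2 *
            (σ ^ 2 * (((min q X.rank : ℕ) : ℝ) + m) * r
              + σ ^ 2 * ((p : ℝ) - q) * Real.log q + σ ^ 2)) := by
  refine ⟨1024, by norm_num, ?_⟩
  intro Ω _ μ _ n p m q r l₀ X Y Bstar Bhat σ δ hσ hδ _ hE hrank hrows hqp hBm hopt hconv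
  exact theorem3_general hσ hδ hE.aemeasurable hE.psi2_le ⟨hrows, hrank⟩ hqp hBm
    (hopt.mono fun ω hω => hω.1) (by
      filter_upwards [hopt, hconv] with ω hω hcω
      exact hω.basic_inequality ⟨hrows, hrank⟩ (hcω _ hω.1 _ ⟨hrows, hrank⟩))
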